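/- Let $G=(V,E)$ be a connected simple graph with $V\neq\emptyset$ (finite or infinite, not necessarily locally finite). Regard $G$ as a geodesic metric space by identifying every edge with the interval $[0,1]$, so that its points are the vertices and the points in the interiors of the edges, and the distance of two points is the length of a shortest path joining them. A geodesic triangle consists of three points (not necessarily distinct) and three geodesics joining them. For a geodesic triangle $T$ let $\delta(T)$ be the infimum of all $\delta\ge 0$ such that each side of $T$ is contained in the $\delta$-neighborhood of the union of the two other sides, and for a metric space $X$ let $\delta(X)\in[0,\infty]$ be the supremum of $\delta(T)$ over all geodesic triangles $T$ in $X$. An edge $e\in E$ is a cut-edge of $G$ if the graph $G\setminus e$ obtained by deleting $e$ (and keeping all vertices) is not connected. For an edge $e=[A,B]$, the contraction $G/e$ is the simple graph obtained from $G$ by removing $e$ and merging $A$ and $B$ into one vertex, where two edges $[v,A]$, $[v,B]$ of $G$ are replaced by a single edge. If $e$ is a cut-edge of $G$, then $$\delta(G/e)=\delta(G).$$ -/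

import Mathlib

open scoped ENNReal

/-! ### Gromov hyperbolicity: the sharp thinness constant of geodesic triangles -/

/-- `s` is (the image of) a geodesic from `x` to `y`: it is the image of a curve parametrized by
arc length on an interval `[0, L]`, with `d(γ a, γ b) = |a - b|`, which starts at `x` and ends
at `y`. -/
def IsGeodesicFromTo {X : Type*} [EMetricSpace X] (x y : X) (s : Set X) : Prop :=
  ∃ (L : ℝ) (γ : ℝ → X), 0 ≤ L ∧
    (∀ a ∈ Set.Icc 0 L, ∀ b ∈ Set.Icc 0 L, edist (γ a) (γ b) = edist a b) ∧
    γ 0 = x ∧ γ L = y ∧ γ '' Set.Icc 0 L = s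

/-- A geodesic triangle: three points, not necessarily distinct, and three geodesics joining
them. -/
structure GeodesicTriangle (X : Type*) [EMetricSpace X] where
  x₁ : X
  x₂ : X
  x₃ : X
  side₁₂ : Set X
  side₂₃ : Set X
  side₃₁ : Set X
  isGeodesic₁₂ : IsGeodesicFromTo x₁ x₂ side₁₂
  isGeodesic₂₃ : IsGeodesicFromTo x₂ x₃ side₂₃
  isGeodesic₃₁ : IsGeodesicFromTo x₃ x₁ side₃₁

/-- The triangle is `δ`-thin: each side is contained in the `δ`-neighborhood of the union of the
other two sides. -/
def GeodesicTriangle.IsThin {X : Type*} [EMetricSpace X] (T : GeodesicTriangle X) (δ : ℝ≥0∞) :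
    Prop :=
  (∀ p ∈ T.side₁₂, Metric.infEDist p (T.side₂₃ ∪ T.side₃₁) ≤ δ) ∧
  (∀ p ∈ T.side₂₃, Metric.infEDist p (T.side₃₁ ∪ T.side₁₂) ≤ δ) ∧
  (∀ p ∈ T.side₃₁, Metric.infEDist p (T.side₁₂ ∪ T.side₂₃) ≤ δ)

/-- The sharp thin constant of a geodesic triangle. -/
noncomputable def GeodesicTriangle.thinConstant {X : Type*} [EMetricSpace X]
    (T : GeodesicTriangle X) : ℝ≥0∞ :=
  sInf {δ : ℝ≥0∞ | T.IsThin δ}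

/-- The sharp hyperbolicity constant of `X`, with values in `[0, ∞]`. -/
noncomputable def hyperbolicityConstant (X : Type*) [EMetricSpace X] : ℝ≥0∞ :=
  ⨆ T : GeodesicTriangle X, T.thinConstant

namespace SimpleGraph

/-! ### A graph as a metric space with edges of length one -/

/-- The points of the graph `G`, regarded as a metric graph, in barycentric coordinates: a vertex
`u` is the function with value `1` at `u` and `0` elsewhere, and the point of the edge `[u, v]` at
distance `t` from `u` is the function with value `1 - t` at `u`, `t` at `v`, and `0` elsewhere. -/
@[ext]
structure Realization {V : Type*} (G : SimpleGraph V) where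
  coord : V →₀ ℝ
  exists_eq : ∃ (u v : V) (t : ℝ), (u = v ∨ G.Adj u v) ∧ 0 ≤ t ∧ t ≤ 1 ∧
    coord = Finsupp.single u (1 - t) + Finsupp.single v t

namespace Realization

variable {V : Type*} {G : SimpleGraph V}

/-- `IsPathLength x y ℓ` says that `ℓ` is the length of a path from `x` to `y` in the metric graph:
either the segment from `x` to `y` in an edge (or vertex) containing both, or the concatenation of
the segment from `x` to an endpoint `u` of its edge, a walk from `u` to `v`, and the segment from
an endpoint `v` of the edge of `y` to `y`. The point with coordinates `c` is at distance `1 - c u`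
from the endpoint `u` of its edge. -/
inductive IsPathLength (x y : G.Realization) : ℝ → Prop
  | along_edge (u v : V) (huv : u = v ∨ G.Adj u v) (hx : (x.coord.support : Set V) ⊆ {u, v})
      (hy : (y.coord.support : Set V) ⊆ {u, v}) : IsPathLength x y |x.coord u - y.coord u|
  | through_vertices (u v : V) (hu : u ∈ x.coord.support) (hv : v ∈ y.coord.support)
      (p : G.Walk u v) : IsPathLength x y ((1 - x.coord u) + p.length + (1 - y.coord v))

/-- The distance of two points: the infimum of the lengths of the paths joining them. -/
noncomputable instance : EDist G.Realization :=
  ⟨fun x y => ⨅ (ℓ : ℝ) (_ : IsPathLength x y ℓ), ENNReal.ofReal ℓ⟩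

theorem edist_def (x y : G.Realization) :
    EDist.edist x y = ⨅ (ℓ : ℝ) (_ : IsPathLength x y ℓ), ENNReal.ofReal ℓ := rfl

theorem coord_nonneg (x : G.Realization) (w : V) : 0 ≤ x.coord w := by
  classical
  obtain ⟨u, v, t, -, h0, h1, h⟩ := x.exists_eq
  rw [h]
  simp only [Finsupp.add_apply, Finsupp.single_apply]
  split_ifs <;> linarith

theorem coord_add_le_one (x : G.Realization) {a b : V} (hab : a ≠ b) :
    x.coord a + x.coord b ≤ 1 := by
  classical
  obtain ⟨u, v, t, -, h0, h1, h⟩ := x.exists_eq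
  rw [h]
  simp only [Finsupp.add_apply, Finsupp.single_apply]
  split_ifs <;> first | linarith | (exfalso; apply hab; simp_all)

theorem coord_le_one (x : G.Realization) (a : V) : x.coord a ≤ 1 := by
  classical
  obtain ⟨u, v, t, -, h0, h1, h⟩ := x.exists_eq
  rw [h]
  simp only [Finsupp.add_apply, Finsupp.single_apply]
  split_ifs <;> linarith

theorem sum_coord (x : G.Realization) : (x.coord.sum fun _ t => t) = 1 := by
  obtain ⟨u, v, t, -, -, -, h⟩ := x.exists_eq
  rw [h, Finsupp.sum_add_index' (fun _ => rfl) (fun _ _ _ => rfl),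
    Finsupp.sum_single_index rfl, Finsupp.sum_single_index rfl]
  ring

theorem coord_add_eq_one (x : G.Realization) {u v : V} (huv : u ≠ v)
    (hx : (x.coord.support : Set V) ⊆ {u, v}) : x.coord u + x.coord v = 1 := by
  classical
  have := x.sum_coord
  rwa [Finsupp.sum_of_support_subset x.coord (s := {u, v}) (by rw [← Finset.coe_subset]; simpa using hx) _
    (by simp),
    Finset.sum_pair huv] at this

theorem coord_eq_one (x : G.Realization) {u : V}
    (hx : (x.coord.support : Set V) ⊆ {u, u}) : x.coord u = 1 := by
  classical
  have := x.sum_coord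
  rwa [Finsupp.sum_of_support_subset x.coord (s := {u}) (by rw [← Finset.coe_subset]; simpa only [Finset.coe_singleton, Set.pair_eq_singleton] using hx) _
    (by simp),
    Finset.sum_singleton] at this

theorem eq_or_adj (x : G.Realization) {a b : V} (ha : a ∈ x.coord.support)
    (hb : b ∈ x.coord.support) : a = b ∨ G.Adj a b ∧ x.coord a + x.coord b = 1 := by
  classical
  obtain ⟨u, v, t, huv, h0, h1, h⟩ := x.exists_eq
  have hs : (x.coord.support : Set V) ⊆ {u, v} := by
    intro w hw
    by_contra hc
    simp only [Set.mem_insert_iff, Set.mem_singleton_iff, not_or] at hc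
    simp [h, Ne.symm hc.1, Ne.symm hc.2] at hw
  by_cases hab : a = b
  · exact Or.inl hab
  right
  have ha' := hs ha
  have hb' := hs hb
  simp only [Set.mem_insert_iff, Set.mem_singleton_iff] at ha' hb'
  rcases ha' with rfl | rfl <;> rcases hb' with rfl | rfl
  · exact absurd rfl hab
  · exact ⟨huv.resolve_left hab, x.coord_add_eq_one hab hs⟩
  · exact ⟨(huv.resolve_left (Ne.symm hab)).symm,
      by rw [add_comm]; exact x.coord_add_eq_one (Ne.symm hab) hs⟩
  · exact absurd rfl hab

theorem IsPathLength.symm {x y : G.Realization} {ℓ : ℝ} (h : IsPathLength x y ℓ) :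
    IsPathLength y x ℓ := by
  cases h with
  | along_edge u v huv hx hy => rw [abs_sub_comm]; exact .along_edge u v huv hy hx
  | through_vertices u v hu hv p =>
    have := IsPathLength.through_vertices (x := y) (y := x) v u hv hu p.reverse
    rw [Walk.length_reverse] at this
    convert this using 1
    ring

/-- The coordinates are 1-Lipschitz. -/
theorem IsPathLength.abs_sub_le {x y : G.Realization} {ℓ : ℝ} (h : IsPathLength x y ℓ) (w : V) :
    |x.coord w - y.coord w| ≤ ℓ := by
  cases h with
  | along_edge u v huv hx hy =>
    by_cases hw : w ∈ ({u, v} : Set V)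
    · rcases hw with rfl | hw
      · exact le_rfl
      · obtain rfl : w = v := hw
        by_cases h : u = w
        · rw [h]
        · have h1 := x.coord_add_eq_one h hx
          have h2 := y.coord_add_eq_one h hy
          have : x.coord w - y.coord w = -(x.coord u - y.coord u) := by linarith
          rw [this, abs_neg]
    · have h1 : x.coord w = 0 := by
        by_contra hc; exact hw (hx (by simpa using hc))
      have h2 : y.coord w = 0 := by
        by_contra hc; exact hw (hy (by simpa using hc))
      rw [h1, h2]; simp
  | through_vertices u v hu hv p =>
    have hx0 := x.coord_nonneg w
    have hy0 := y.coord_nonneg w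
    have hx1 := x.coord_le_one w
    have hy1 := y.coord_le_one w
    have hxu := x.coord_le_one u
    have hyv := y.coord_le_one v
    by_cases huv : u = v
    · subst huv
      have hp : (0 : ℝ) ≤ p.length := by positivity
      by_cases hw : w = u
      · subst hw; rw [abs_le]; constructor <;> linarith
      · have h1 := x.coord_add_le_one hw
        have h2 := y.coord_add_le_one hw
        rw [abs_le]; constructor <;> linarith
    · have hp : (1 : ℝ) ≤ p.length := by
        have : p.length ≠ 0 := fun h => huv (Walk.eq_of_length_eq_zero h)
        exact_mod_cast Nat.one_le_iff_ne_zero.mpr this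
      rw [abs_le]; constructor <;> linarith

/-- Sliding the starting point along an edge. -/
theorem IsPathLength.slide {x y z : G.Realization} {u v a b : V} (huv : u = v ∨ G.Adj u v)
    (hx : (x.coord.support : Set V) ⊆ {u, v}) (hy : (y.coord.support : Set V) ⊆ {u, v})
    (ha : a ∈ y.coord.support) (hb : b ∈ z.coord.support) (p : G.Walk a b) :
    ∃ ℓ, IsPathLength x z ℓ ∧
      ℓ ≤ |x.coord u - y.coord u| + ((1 - y.coord a) + p.length + (1 - z.coord b)) := by
  have hl : ∀ w, |x.coord w - y.coord w| ≤ |x.coord u - y.coord u| :=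
    (IsPathLength.along_edge u v huv hx hy).abs_sub_le
  have h1 := (abs_le.mp (hl a)).1
  by_cases hax : a ∈ x.coord.support
  · exact ⟨_, .through_vertices a b hax hb p, by linarith⟩
  · have hxa : x.coord a = 0 := by simpa using hax
    obtain ⟨c, hc, hca, hadj⟩ : ∃ c, x.coord c = 1 ∧ c ∈ x.coord.support ∧ G.Adj c a := by
      have ha' := hy ha
      rcases huv with rfl | huv
      · have hau : a = u := by simpa using ha'
        subst hau
        rw [x.coord_eq_one hx] at hxa
        exact absurd hxa one_ne_zero
      · have hs := x.coord_add_eq_one huv.ne hx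
        rcases ha' with rfl | ha'
        · have : x.coord v = 1 := by linarith
          exact ⟨v, this, by simp [this], huv.symm⟩
        · obtain rfl : a = v := ha'
          have : x.coord u = 1 := by linarith
          exact ⟨u, this, by simp [this], huv⟩
    refine ⟨_, .through_vertices c b hca hb (Walk.cons hadj p), ?_⟩
    rw [Walk.length_cons]
    push_cast
    linarith

theorem IsPathLength.trans {x y z : G.Realization} {k l : ℝ} (h : IsPathLength x y k)
    (h' : IsPathLength y z l) : ∃ m, IsPathLength x z m ∧ m ≤ k + l := by
  cases h with
  | along_edge u v huv hx hy =>
    cases h' with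
    | through_vertices a b ha hb p => exact slide huv hx hy ha hb p
    | along_edge a b hab hy' hz =>
      by_cases hsub : (z.coord.support : Set V) ⊆ {u, v}
      · refine ⟨_, .along_edge u v huv hx hsub, ?_⟩
        have := (IsPathLength.along_edge a b hab hy' hz).abs_sub_le u
        exact (_root_.abs_sub_le _ (y.coord u) _).trans (by linarith)
      · -- `y` is then a vertex
        obtain ⟨c, hcz, hcn⟩ := Set.not_subset.mp hsub
        have hcab := hz hcz
        obtain ⟨d, hd, hds, hdab⟩ : ∃ d, y.coord d = 1 ∧ d ∈ y.coord.support ∧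
            (d = c ∨ G.Adj d c) := by
          have hyc : y.coord c = 0 := by
            by_contra hc; exact hcn (hy (by simpa using hc))
          rcases hab with rfl | hab
          · have : c = a := by simpa using hcab
            subst this
            rw [y.coord_eq_one hy'] at hyc
            exact absurd hyc one_ne_zero
          · have hs := y.coord_add_eq_one hab.ne hy'
            rcases hcab with rfl | hcab
            · have : y.coord b = 1 := by linarith
              exact ⟨b, this, by simp [this], Or.inr hab.symm⟩
            · obtain rfl : c = b := hcab
              have : y.coord a = 1 := by linarith
              exact ⟨a, this, by simp [this], Or.inr hab⟩
        have hyc : y.coord c = 0 := by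
          by_contra hc; exact hcn (hy (by simpa using hc))
        have hadj : G.Adj d c := by
          rcases hdab with rfl | h
          · rw [hyc] at hd; exact absurd hd zero_ne_one
          · exact h
        obtain ⟨m, hm, hle⟩ := slide huv hx hy hds hcz (Walk.cons hadj Walk.nil)
        have h2 : |y.coord c - z.coord c| ≤ |y.coord a - z.coord a| :=
          (IsPathLength.along_edge a b hab hy' hz).abs_sub_le c
        have h3 : |y.coord d - z.coord d| ≤ |y.coord a - z.coord a| :=
          (IsPathLength.along_edge a b hab hy' hz).abs_sub_le d
        by_cases hdz : d ∈ z.coord.support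
        · obtain ⟨m, hm, hle⟩ := slide huv hx hy hds hdz Walk.nil
          refine ⟨m, hm, hle.trans ?_⟩
          have := (abs_le.mp h3).2
          simp only [Walk.length_nil, Nat.cast_zero]
          linarith
        · refine ⟨m, hm, hle.trans ?_⟩
          have hz0 : z.coord d = 0 := by simpa using hdz
          rw [hd, hz0] at h3
          have hzc : z.coord c = 1 := by
            have hc1 : 1 ≤ |y.coord a - z.coord a| := by simpa using h3
            have hdab' := hy' hds
            rcases hab with rfl | hab
            · exfalso
              have h1 : d = a := by simpa using hdab'
              have h2 : c = a := by simpa using hcab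
              exact hadj.ne (h1.trans h2.symm)
            · have hs := z.coord_add_eq_one hab.ne hz
              rcases hcab with rfl | hcab
              · rcases hdab' with rfl | hdab'
                · exact absurd rfl hadj.ne
                · obtain rfl : d = b := hdab'
                  linarith
              · obtain rfl : c = b := hcab
                rcases hdab' with rfl | hdab'
                · linarith
                · exact absurd hdab' hadj.ne
          have h4 : (1 : ℝ) ≤ |y.coord a - z.coord a| := by simpa using h3
          simp only [Walk.length_cons, Walk.length_nil, hd, hzc]
          push_cast
          linarith
  | through_vertices a b ha hb p =>
    cases h' with
    | along_edge u v huv hy hz =>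
      obtain ⟨m, hm, hle⟩ := slide (x := z) (y := y) (z := x) huv hz hy hb ha p.reverse
      refine ⟨m, hm.symm, hle.trans ?_⟩
      rw [abs_sub_comm, Walk.length_reverse]
      linarith
    | through_vertices c d hc hd q =>
      have hyb := y.coord_le_one b
      have hyc := y.coord_le_one c
      rcases y.eq_or_adj hb hc with rfl | ⟨hadj, hsum⟩
      · refine ⟨_, .through_vertices a d ha hd (p.append q), ?_⟩
        rw [Walk.length_append]; push_cast; linarith
      · refine ⟨_, .through_vertices a d ha hd (p.append (Walk.cons hadj q)), ?_⟩
        rw [Walk.length_append, Walk.length_cons]; push_cast; linarith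

theorem IsPathLength.nonneg {x y : G.Realization} {ℓ : ℝ} (h : IsPathLength x y ℓ) : 0 ≤ ℓ := by
  obtain ⟨u, _⟩ := x.exists_eq
  exact (abs_nonneg _).trans (h.abs_sub_le u)

/-- The metric graph is a metric space; distances are finite when the graph is connected. -/
noncomputable instance : EMetricSpace G.Realization where
  edist_self x := by
    classical
    obtain ⟨u, v, t, huv, -, -, h⟩ := x.exists_eq
    have hs : (x.coord.support : Set V) ⊆ {u, v} := by
      intro w hw
      by_contra hc
      simp only [Set.mem_insert_iff, Set.mem_singleton_iff, not_or] at hc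
      simp [h, Ne.symm hc.1, Ne.symm hc.2] at hw
    refine le_antisymm ?_ zero_le
    exact (iInf₂_le _ (IsPathLength.along_edge u v huv hs hs)).trans (by simp)
  edist_comm x y := by
    apply le_antisymm <;> exact le_iInf₂ fun ℓ h => iInf₂_le ℓ h.symm
  edist_triangle x y z := by
    rw [edist_def x y, edist_def y z]
    simp only [ENNReal.iInf_add, ENNReal.add_iInf]
    refine le_iInf₂ fun k hk => le_iInf₂ fun l hl => ?_
    rw [← ENNReal.ofReal_add (IsPathLength.nonneg ‹_›) (IsPathLength.nonneg ‹_›)]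
    obtain ⟨m, hm, hle⟩ := IsPathLength.trans ‹IsPathLength x y _› ‹IsPathLength y z _›
    exact (iInf₂_le m hm).trans (ENNReal.ofReal_le_ofReal (by linarith))
  eq_of_edist_eq_zero {x y} h := by
    ext w
    have : ENNReal.ofReal |x.coord w - y.coord w| ≤ EDist.edist x y :=
      le_iInf₂ fun ℓ h => ENNReal.ofReal_le_ofReal (h.abs_sub_le w)
    rw [h] at this
    have h0 : |x.coord w - y.coord w| ≤ 0 := by simpa using this
    exact sub_eq_zero.mp (abs_nonpos_iff.mp h0)

end Realization

/-! ### Cut-edges and edge contraction -/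

variable {V : Type*}

/-- `e` is an edge of `G` and `G ∖ e` is not connected. -/
def IsCutEdge (G : SimpleGraph V) (e : Sym2 V) : Prop :=
  e ∈ G.edgeSet ∧ ¬ (G.deleteEdges {e}).Connected

/-- The equivalence relation on vertices which identifies the two endpoints of `e`, and nothing
else. -/
def contractSetoid (e : Sym2 V) : Setoid V where
  r a b := a = b ∨ (a ∈ e ∧ b ∈ e)
  iseqv :=
    { refl := fun _ => Or.inl rfl
      symm := by
        rintro a b (rfl | ⟨ha, hb⟩)
        · exact Or.inl rfl
        · exact Or.inr ⟨hb, ha⟩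
      trans := by
        rintro a b c (rfl | ⟨ha, hb⟩) (rfl | ⟨hb', hc⟩)
        · exact Or.inl rfl
        · exact Or.inr ⟨hb', hc⟩
        · exact Or.inr ⟨ha, hb⟩
        · exact Or.inr ⟨ha, hc⟩ }

/-- The simple graph `G/e`: the endpoints of `e` are merged into one vertex, the edge `e` is
removed, and parallel edges are replaced by a single edge. -/
def contractEdge (G : SimpleGraph V) (e : Sym2 V) : SimpleGraph (Quotient (contractSetoid e)) where
  Adj p q := p ≠ q ∧ ∃ a b : V, G.Adj a b ∧
    Quotient.mk (contractSetoid e) a = p ∧ Quotient.mk (contractSetoid e) b = q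
  symm := ⟨fun _ _ ⟨hne, a, b, hab, ha, hb⟩ => ⟨hne.symm, b, a, hab.symm, hb, ha⟩⟩
  loopless := ⟨fun _ h => h.1 rfl⟩

end SimpleGraph

/-! Deleting the cut-edge `e = [A, B]` splits the vertices into `S ∋ A` and `Sᶜ ∋ B`, and `e` is the
only edge between them. As a metric space, `G` is therefore the part over `S`, the segment `e` and
the part over `Sᶜ`, glued in a row at the points `A` and `B`; `G/e` is the same two parts glued
directly at the merged vertex. Neither one-point gluing nor the presence of the segment affects the
bound for thin triangles, so both constants are governed by the same two parts.

Three facts carry this. A one-point union of two `δ`-hyperbolic sets is `δ`-hyperbolic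
(`IsWedgeAt.isHyperbolicOn_union`), because retracting a triangle onto one set gives a geodesic
triangle there. A segment is `0`-hyperbolic, being isometric to a subset of the line
(`isHyperbolicOn_span_pair`). Finally, the part over `S` has the same metric in `G` and in `G/e`
(`isHyperbolicOn_contract_iff`), because the projection and a section of it are both 1-Lipschitz; by
symmetry the same holds over `Sᶜ`. -/

/-! ### Geodesics in extended metric spaces -/

namespace IsGeodesicFromTo

variable {X Y : Type*} [EMetricSpace X] [EMetricSpace Y] {x y : X} {s : Set X}

theorem left_mem (h : IsGeodesicFromTo x y s) : x ∈ s := by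
  obtain ⟨L, γ, hL, -, h0, -, rfl⟩ := h
  exact ⟨0, ⟨le_rfl, hL⟩, h0⟩

theorem right_mem (h : IsGeodesicFromTo x y s) : y ∈ s := by
  obtain ⟨L, γ, hL, -, -, h1, rfl⟩ := h
  exact ⟨L, ⟨hL, le_rfl⟩, h1⟩

theorem symm (h : IsGeodesicFromTo x y s) : IsGeodesicFromTo y x s := by
  obtain ⟨L, γ, hL, hγ, h0, h1, rfl⟩ := h
  have hmem : ∀ a ∈ Set.Icc 0 L, L - a ∈ Set.Icc 0 L := fun a ha =>
    ⟨by linarith [ha.2], by linarith [ha.1]⟩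
  refine ⟨L, fun t => γ (L - t), hL, ?_, by simpa using h1, by simpa using h0, ?_⟩
  · intro a ha b hb
    rw [hγ _ (hmem a ha) _ (hmem b hb), edist_dist, edist_dist, Real.dist_eq, Real.dist_eq,
      abs_sub_comm]
    congr 2
    ring
  · ext p
    constructor
    · rintro ⟨a, ha, rfl⟩
      exact ⟨L - a, hmem a ha, rfl⟩
    · rintro ⟨a, ha, rfl⟩
      exact ⟨L - a, hmem a ha, by simp⟩

theorem image (h : IsGeodesicFromTo x y s) {f : X → Y}
    (hf : ∀ a ∈ s, ∀ b ∈ s, edist (f a) (f b) = edist a b) :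
    IsGeodesicFromTo (f x) (f y) (f '' s) := by
  obtain ⟨L, γ, hL, hγ, rfl, rfl, rfl⟩ := h
  refine ⟨L, f ∘ γ, hL, fun a ha b hb => ?_, rfl, rfl, Set.image_comp _ _ _⟩
  rw [← hγ a ha b hb]
  exact hf _ ⟨a, ha, rfl⟩ _ ⟨b, hb, rfl⟩

theorem singleton (x : X) : IsGeodesicFromTo x x {x} :=
  ⟨0, fun _ => x, le_rfl, by simp, rfl, rfl, by simp⟩

theorem edist_ne_top_of_mem (h : IsGeodesicFromTo x y s) {p q : X} (hp : p ∈ s) (hq : q ∈ s) :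
    edist p q ≠ ⊤ := by
  obtain ⟨L, γ, hL, hγ, -, -, rfl⟩ := h
  obtain ⟨a, ha, rfl⟩ := hp
  obtain ⟨b, hb, rfl⟩ := hq
  rw [hγ a ha b hb]
  exact edist_ne_top _ _

theorem edist_eq_add (h : IsGeodesicFromTo x y s) {p : X} (hp : p ∈ s) :
    edist x y = edist x p + edist p y := by
  obtain ⟨L, γ, hL, hγ, rfl, rfl, rfl⟩ := h
  obtain ⟨a, ha, rfl⟩ := hp
  have h0 : (0 : ℝ) ∈ Set.Icc 0 L := ⟨le_rfl, hL⟩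
  have h1 : L ∈ Set.Icc 0 L := ⟨hL, le_rfl⟩
  rw [hγ _ h0 _ h1, hγ _ h0 _ ha, hγ _ ha _ h1]
  simp only [edist_dist, Real.dist_eq]
  rw [← ENNReal.ofReal_add (abs_nonneg _) (abs_nonneg _), abs_sub_comm 0 L, abs_sub_comm 0 a,
    abs_sub_comm a L, abs_of_nonneg (by linarith), abs_of_nonneg (by linarith [ha.1]),
    abs_of_nonneg (by linarith [ha.2])]
  congr 1
  ring

theorem exists_edist_eq (h : IsGeodesicFromTo x y s) {d : ℝ≥0∞} (hd : d ≤ edist x y) :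
    ∃ q ∈ s, edist x q = d := by
  have htop : d ≠ ⊤ := ne_top_of_le_ne_top (h.edist_ne_top_of_mem h.left_mem h.right_mem) hd
  obtain ⟨L, γ, hL, hγ, rfl, rfl, rfl⟩ := h
  have h0 : (0 : ℝ) ∈ Set.Icc 0 L := ⟨le_rfl, hL⟩
  have h1 : L ∈ Set.Icc 0 L := ⟨hL, le_rfl⟩
  rw [hγ _ h0 _ h1, edist_dist, Real.dist_eq, zero_sub, abs_neg, abs_of_nonneg hL] at hd
  have hm : d.toReal ∈ Set.Icc 0 L := ⟨ENNReal.toReal_nonneg, ENNReal.toReal_le_of_le_ofReal hL hd⟩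
  refine ⟨γ d.toReal, ⟨_, hm, rfl⟩, ?_⟩
  rw [hγ _ h0 _ hm, edist_dist, Real.dist_eq, zero_sub, abs_neg, abs_of_nonneg hm.1,
    ENNReal.ofReal_toReal htop]

theorem initial (h : IsGeodesicFromTo x y s) {p : X} (hp : p ∈ s) :
    IsGeodesicFromTo x p {q ∈ s | edist x q ≤ edist x p} := by
  obtain ⟨L, γ, hL, hγ, rfl, rfl, rfl⟩ := h
  obtain ⟨c, hc, rfl⟩ := hp
  have h0 : (0 : ℝ) ∈ Set.Icc 0 L := ⟨le_rfl, hL⟩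
  refine ⟨c, γ, hc.1, fun a ha b hb => hγ a ⟨ha.1, ha.2.trans hc.2⟩ b ⟨hb.1, hb.2.trans hc.2⟩,
    rfl, rfl, ?_⟩
  have key : ∀ a ∈ Set.Icc 0 L, edist (γ 0) (γ a) ≤ edist (γ 0) (γ c) ↔ a ≤ c := by
    intro a ha
    rw [hγ _ h0 _ ha, hγ _ h0 _ hc, edist_dist, edist_dist, Real.dist_eq, Real.dist_eq,
      ENNReal.ofReal_le_ofReal_iff (abs_nonneg _), zero_sub, zero_sub, abs_neg, abs_neg,
      abs_of_nonneg ha.1, abs_of_nonneg hc.1]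
  ext q
  constructor
  · rintro ⟨a, ha, rfl⟩
    have ha' : a ∈ Set.Icc 0 L := ⟨ha.1, ha.2.trans hc.2⟩
    exact ⟨⟨a, ha', rfl⟩, (key a ha').2 ha.2⟩
  · rintro ⟨⟨a, ha, rfl⟩, hle⟩
    exact ⟨a, ⟨ha.1, (key a ha).1 hle⟩, rfl⟩

end IsGeodesicFromTo

/-! ### Thin triangles inside a subset -/

/-- Every geodesic triangle with sides in `S` is `δ`-thin. -/
def IsHyperbolicOn {X : Type*} [EMetricSpace X] (S : Set X) (δ : ℝ≥0∞) : Prop :=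
  ∀ ⦃x y z : X⦄ ⦃s t u : Set X⦄, IsGeodesicFromTo x y s → IsGeodesicFromTo y z t →
    IsGeodesicFromTo z x u → s ⊆ S → t ⊆ S → u ⊆ S → ∀ p ∈ s, Metric.infEDist p (t ∪ u) ≤ δ

/-- The infimum is attained: thinness is a family of non-strict bounds `≤ δ`, each of which passes
to the infimum. -/
theorem GeodesicTriangle.thinConstant_le_iff {X : Type*} [EMetricSpace X] (T : GeodesicTriangle X)
    (δ : ℝ≥0∞) : T.thinConstant ≤ δ ↔ T.IsThin δ := by
  refine ⟨fun h => ?_, fun h => sInf_le h⟩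
  refine ⟨fun p hp => ?_, fun p hp => ?_, fun p hp => ?_⟩ <;> refine le_trans (le_sInf ?_) h
  exacts [fun ε hε => hε.1 p hp, fun ε hε => hε.2.1 p hp, fun ε hε => hε.2.2 p hp]

/-- `IsHyperbolicOn` tests a single side; rotating the triangle cyclically recovers the other two.
-/
theorem hyperbolicityConstant_le_iff {X : Type*} [EMetricSpace X] (δ : ℝ≥0∞) :
    hyperbolicityConstant X ≤ δ ↔ IsHyperbolicOn (Set.univ : Set X) δ := by
  simp only [hyperbolicityConstant, iSup_le_iff, GeodesicTriangle.thinConstant_le_iff]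
  constructor
  · intro h x y z s t u hs ht hu _ _ _
    exact (h ⟨x, y, z, s, t, u, hs, ht, hu⟩).1
  · rintro h ⟨x, y, z, s, t, u, hs, ht, hu⟩
    have hsub : ∀ s : Set X, s ⊆ Set.univ := Set.subset_univ
    exact ⟨h hs ht hu (hsub _) (hsub _) (hsub _), h ht hu hs (hsub _) (hsub _) (hsub _),
      h hu hs ht (hsub _) (hsub _) (hsub _)⟩

namespace IsHyperbolicOn

variable {X Y : Type*} [EMetricSpace X] [EMetricSpace Y] {S T : Set X} {δ : ℝ≥0∞}

theorem mono (h : IsHyperbolicOn T δ) (hST : S ⊆ T) : IsHyperbolicOn S δ :=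
  fun _ _ _ _ _ _ hs ht hu hs' ht' hu' =>
    h hs ht hu (hs'.trans hST) (ht'.trans hST) (hu'.trans hST)

theorem of_isometryOn {S' : Set Y} (h : IsHyperbolicOn S' δ) {f : X → Y} (hmaps : Set.MapsTo f S S')
    (hf : ∀ a ∈ S, ∀ b ∈ S, edist (f a) (f b) = edist a b) : IsHyperbolicOn S δ := by
  intro x y z s t u hs ht hu hs' ht' hu' p hp
  have him : ∀ {x y s}, IsGeodesicFromTo x y s → s ⊆ S →
      IsGeodesicFromTo (f x) (f y) (f '' s) := fun h hS =>
    h.image fun a ha b hb => hf a (hS ha) b (hS hb)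
  have hsub : ∀ {s}, s ⊆ S → f '' s ⊆ S' := fun hS => (hmaps.mono_left hS).image_subset
  refine le_trans ?_ (h (him hs hs') (him ht ht') (him hu hu') (hsub hs') (hsub ht') (hsub hu')
    (f p) ⟨p, hp, rfl⟩)
  rw [← Set.image_union, Metric.le_infEDist]
  rintro _ ⟨q, hq, rfl⟩
  rw [hf p (hs' hp) q (Set.union_subset ht' hu' hq)]
  exact Metric.infEDist_le_edist_of_mem hq

/-- A geodesic in the line is exactly the interval between its endpoints: additivity of distance
along it gives one inclusion, the intermediate value theorem the other. Each side then lies in the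
union of the other two. -/
theorem real_univ : IsHyperbolicOn (Set.univ : Set ℝ) 0 := by
  have sub : ∀ {x y : ℝ} {s}, IsGeodesicFromTo x y s → s ⊆ Set.uIcc x y := by
    intro x y s hs p hp
    have h := hs.edist_eq_add hp
    simp only [edist_dist, Real.dist_eq] at h
    rw [← ENNReal.ofReal_add (abs_nonneg _) (abs_nonneg _),
      ENNReal.ofReal_eq_ofReal_iff (abs_nonneg _) (by positivity)] at h
    rw [Set.mem_uIcc]
    by_contra hc
    grind
  have sup : ∀ {x y : ℝ} {s}, IsGeodesicFromTo x y s → Set.uIcc x y ⊆ s := by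
    rintro x y s ⟨L, γ, hL, hγ, rfl, rfl, rfl⟩
    have hcont : ContinuousOn γ (Set.uIcc 0 L) := by
      rw [Set.uIcc_of_le hL]
      have : LipschitzOnWith 1 γ (Set.Icc 0 L) := fun a ha b hb => by
        rw [hγ a ha b hb]; simp
      exact this.continuousOn
    have := intermediate_value_uIcc hcont
    rwa [Set.uIcc_of_le hL] at this
  intro x y z s t u hs ht hu _ _ _ p hp
  have hp' := Set.uIcc_subset_uIcc_union_uIcc (b := z) (sub hs hp)
  rw [Set.uIcc_comm x z, Set.union_comm, Set.uIcc_comm z y] at hp'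
  exact (Metric.infEDist_zero_of_mem (Set.union_subset_union (sup ht) (sup hu) hp')).le

end IsHyperbolicOn

/-! ### One-point unions -/

/-- The sets `S` and `T` are glued at the point `o`: paths from `S` to `T` pass through `o`. -/
structure IsWedgeAt {X : Type*} [EMetricSpace X] (S T : Set X) (o : X) : Prop where
  mem_left : o ∈ S
  mem_right : o ∈ T
  edist_eq : ∀ x ∈ S, ∀ y ∈ T, edist x y = edist x o + edist o y

namespace IsWedgeAt

section Retract

open Classical in
/-- The retraction onto `S` which sends everything else to `o`. -/
noncomputable def retract {X : Type*} (S : Set X) (o : X) (x : X) : X := if x ∈ S then x else o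

variable {X : Type*} {S : Set X} {o x : X}

theorem retract_of_mem (hx : x ∈ S) : retract S o x = x := if_pos hx

theorem retract_of_notMem (hx : x ∉ S) : retract S o x = o := if_neg hx

theorem retract_mem (ho : o ∈ S) (x : X) : retract S o x ∈ S := by
  unfold retract
  split_ifs <;> assumption

end Retract

variable {X : Type*} [EMetricSpace X] {S T : Set X} {o x y z : X} {s t u : Set X}

theorem symm (h : IsWedgeAt S T o) : IsWedgeAt T S o :=
  ⟨h.mem_right, h.mem_left, fun x hx y hy => by
    rw [edist_comm x y, h.edist_eq y hy x hx, add_comm, edist_comm o x, edist_comm y o]⟩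

theorem eq_of_mem (h : IsWedgeAt S T o) (hS : x ∈ S) (hT : x ∈ T) : x = o := by
  have := h.edist_eq x hS x hT
  rw [edist_self] at this
  exact edist_eq_zero.1 (add_eq_zero.1 this.symm).1

/-- The point `q` of the geodesic at distance `d(x, o)` from `x` must be `o`: whichever set contains
`q`, the wedge formula and cancellation of finite distances give `d(q, o) = 0`. -/
theorem mem_geodesic (h : IsWedgeAt S T o) (hs : IsGeodesicFromTo x y s) (hsub : s ⊆ S ∪ T)
    (hx : x ∈ S) (hy : y ∈ T) : o ∈ s := by
  have hxy := h.edist_eq x hx y hy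
  obtain ⟨q, hq, hqd⟩ := hs.exists_edist_eq (d := edist x o) (hxy ▸ le_self_add)
  have hfin : edist x o ≠ ⊤ := hqd ▸ hs.edist_ne_top_of_mem hs.left_mem hq
  have hqo : q = o := by
    rcases hsub hq with hqS | hqT
    · have h1 := hs.edist_eq_add hq
      rw [hxy, hqd, ENNReal.add_right_inj hfin, h.edist_eq q hqS y hy] at h1
      have hfin' : edist o y ≠ ⊤ :=
        ne_top_of_le_ne_top (hs.edist_ne_top_of_mem hs.left_mem hs.right_mem) (hxy ▸ le_add_self)
      have h2 : edist q o + edist o y = 0 + edist o y := by rw [zero_add]; exact h1.symm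
      exact edist_eq_zero.1 ((ENNReal.add_left_inj hfin').1 h2)
    · have h1 := h.edist_eq x hx q hqT
      have h2 : edist x o + edist o q = edist x o + 0 := by rw [add_zero, ← h1, hqd]
      exact (edist_eq_zero.1 ((ENNReal.add_right_inj hfin).1 h2)).symm
  exact hqo ▸ hq

/-- Visiting a point `p` of `T` costs a detour of `2 d(o, p)`, which a geodesic between points of
`S` cannot afford unless `p = o`. -/
theorem geodesic_subset (h : IsWedgeAt S T o) (hs : IsGeodesicFromTo x y s) (hsub : s ⊆ S ∪ T)
    (hx : x ∈ S) (hy : y ∈ S) : s ⊆ S := by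
  intro p hp
  rcases hsub hp with hpS | hpT
  · exact hpS
  have h1 := hs.edist_eq_add hp
  have h2 := h.edist_eq x hx p hpT
  have h3 := h.symm.edist_eq p hpT y hy
  have hfin := hs.edist_ne_top_of_mem hs.left_mem hs.right_mem
  have h4 : edist x y + (edist o p + edist p o) ≤ edist x y + 0 := by
    calc edist x y + (edist o p + edist p o)
        ≤ (edist x o + edist o y) + (edist o p + edist p o) := by
          gcongr; exact edist_triangle _ _ _
      _ = edist x y + 0 := by rw [h1, h2, h3]; ring
  have h5 := (ENNReal.add_le_add_iff_left hfin).1 h4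
  have h6 : o = p := edist_eq_zero.1 (add_eq_zero.1 (nonpos_iff_eq_zero.1 h5)).1
  exact h6 ▸ h.mem_left

/-- The retraction is not isometric, but its effect on a geodesic is to keep it, to cut it off at
`o`, or to collapse it to `o`, according to how many endpoints lie in `S`. -/
theorem geodesic_retract (h : IsWedgeAt S T o) (hs : IsGeodesicFromTo x y s) (hsub : s ⊆ S ∪ T) :
    IsGeodesicFromTo (retract S o x) (retract S o y) (retract S o '' s) := by
  have mixed : ∀ {x y : X}, IsGeodesicFromTo x y s → x ∈ S → y ∉ S →
      IsGeodesicFromTo (retract S o x) (retract S o y) (retract S o '' s) := by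
    intro x y hs hx hy
    have hyT : y ∈ T := (hsub hs.right_mem).resolve_left hy
    have ho := h.mem_geodesic hs hsub hx hyT
    rw [retract_of_mem hx, retract_of_notMem hy]
    -- The image is the initial part of `s` up to `o`: points of `s` in `S` come no later than `o`,
    -- and those outside `S` are sent to `o`.
    convert hs.initial ho using 1
    ext q
    constructor
    · rintro ⟨p, hp, rfl⟩
      by_cases hpS : p ∈ S
      · rw [retract_of_mem hpS]
        refine ⟨hp, ?_⟩
        have h1 := hs.edist_eq_add hp
        rw [h.edist_eq p hpS y hyT, h.edist_eq x hx y hyT, ← add_assoc,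
          ENNReal.add_left_inj (hs.edist_ne_top_of_mem ho hs.right_mem)] at h1
        exact h1 ▸ le_self_add
      · rw [retract_of_notMem hpS]
        exact ⟨ho, le_rfl⟩
    · rintro ⟨hq, hle⟩
      refine ⟨q, hq, ?_⟩
      by_cases hqS : q ∈ S
      · exact retract_of_mem hqS
      · rw [retract_of_notMem hqS]
        have hqT := (hsub hq).resolve_left hqS
        rw [h.edist_eq x hx q hqT] at hle
        have h2 : edist x o + edist o q ≤ edist x o + 0 := by rwa [add_zero]
        have h3 := (ENNReal.add_le_add_iff_left (hs.edist_ne_top_of_mem hs.left_mem ho)).1 h2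
        exact edist_eq_zero.1 (nonpos_iff_eq_zero.1 h3)
  by_cases hx : x ∈ S <;> by_cases hy : y ∈ S
  · have hS := h.geodesic_subset hs hsub hx hy
    exact hs.image fun a ha b hb => by rw [retract_of_mem (hS ha), retract_of_mem (hS hb)]
  · exact mixed hs hx hy
  · exact (mixed hs.symm hy hx).symm
  · have hT := h.symm.geodesic_subset hs (Set.union_comm S T ▸ hsub)
      ((hsub hs.left_mem).resolve_left hx) ((hsub hs.right_mem).resolve_left hy)
    have heq : retract S o '' s = {o} := by
      refine Set.eq_singleton_iff_nonempty_unique_mem.2 ⟨⟨_, x, hs.left_mem, rfl⟩, ?_⟩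
      rintro _ ⟨q, hq, rfl⟩
      by_cases hqS : q ∈ S
      · rw [retract_of_mem hqS, h.eq_of_mem hqS (hT hq)]
      · exact retract_of_notMem hqS
    rw [retract_of_notMem hx, retract_of_notMem hy, heq]
    exact .singleton o

/-- The retraction fixes `p`, and since `o` already lies on `t ∪ u`, the retracted sides stay inside
`t ∪ u`; thinness of the retracted triangle in `S` therefore suffices. -/
theorem infEDist_le {δ : ℝ≥0∞} (h : IsWedgeAt S T o) (hS : IsHyperbolicOn S δ)
    (hs : IsGeodesicFromTo x y s) (ht : IsGeodesicFromTo y z t) (hu : IsGeodesicFromTo z x u)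
    (hs' : s ⊆ S ∪ T) (ht' : t ⊆ S ∪ T) (hu' : u ⊆ S ∪ T) (ho : o ∈ t ∪ u) {p : X} (hp : p ∈ s)
    (hpS : p ∈ S) : Metric.infEDist p (t ∪ u) ≤ δ := by
  have hsub : ∀ s, retract S o '' s ⊆ S := by
    rintro s _ ⟨q, -, rfl⟩
    exact retract_mem h.mem_left q
  have := hS (h.geodesic_retract hs hs') (h.geodesic_retract ht ht') (h.geodesic_retract hu hu')
    (hsub _) (hsub _) (hsub _) p ⟨p, hp, retract_of_mem hpS⟩
  refine (Metric.infEDist_anti ?_).trans this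
  rw [← Set.image_union]
  rintro _ ⟨q, hq, rfl⟩
  by_cases hqS : q ∈ S
  · rwa [retract_of_mem hqS]
  · rwa [retract_of_notMem hqS]

/-- If `o` lies on `t ∪ u`, the retraction onto the set containing `p` applies. Otherwise neither
side at `z` crosses `o`, so all three corners, and hence all three sides, lie in the same set as
`z`. -/
theorem isHyperbolicOn_union {δ : ℝ≥0∞} (h : IsWedgeAt S T o) (hS : IsHyperbolicOn S δ)
    (hT : IsHyperbolicOn T δ) : IsHyperbolicOn (S ∪ T) δ := by
  have key : ∀ {S T : Set X}, IsWedgeAt S T o → IsHyperbolicOn S δ → ∀ {x y z s t u},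
      IsGeodesicFromTo x y s → IsGeodesicFromTo y z t → IsGeodesicFromTo z x u →
      s ⊆ S ∪ T → t ⊆ S ∪ T → u ⊆ S ∪ T → o ∉ t ∪ u → z ∈ S →
      ∀ p ∈ s, Metric.infEDist p (t ∪ u) ≤ δ := by
    intro S T h hS x y z s t u hs ht hu hs' ht' hu' ho hz
    have hy : y ∈ S := by
      by_contra hy
      exact ho (Or.inl (h.mem_geodesic ht.symm ht' hz ((ht' ht.left_mem).resolve_left hy)))
    have hx : x ∈ S := by
      by_contra hx
      exact ho (Or.inr (h.mem_geodesic hu hu' hz ((hu' hu.right_mem).resolve_left hx)))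
    exact hS hs ht hu (h.geodesic_subset hs hs' hx hy) (h.geodesic_subset ht ht' hy hz)
      (h.geodesic_subset hu hu' hz hx)
  intro x y z s t u hs ht hu hs' ht' hu' p hp
  have hcomm := Set.union_comm S T
  by_cases ho : o ∈ t ∪ u
  · rcases hs' hp with hpS | hpT
    · exact h.infEDist_le hS hs ht hu hs' ht' hu' ho hp hpS
    · rw [hcomm] at hs' ht' hu'
      exact h.symm.infEDist_le hT hs ht hu hs' ht' hu' ho hp hpT
  · rcases hu' hu.left_mem with hz | hz
    · exact key h hS hs ht hu hs' ht' hu' ho hz p hp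
    · rw [hcomm] at hs' ht' hu'
      exact key h.symm hT hs ht hu hs' ht' hu' ho hz p hp

end IsWedgeAt

/-! ### Metric graphs: separating vertices and induced maps -/

namespace SimpleGraph

variable {V W : Type*} {G : SimpleGraph V} {H : SimpleGraph W}

/-- A map of vertices which sends every edge to an edge or to a single vertex. -/
def IsWeakHom (G : SimpleGraph V) (H : SimpleGraph W) (φ : V → W) : Prop :=
  ∀ ⦃a b : V⦄, G.Adj a b → φ a = φ b ∨ H.Adj (φ a) (φ b)

theorem IsWeakHom.exists_walk {φ : V → W} (hφ : IsWeakHom G H φ) {u v : V} (p : G.Walk u v) :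
    ∃ q : H.Walk (φ u) (φ v), q.length ≤ p.length := by
  induction p with
  | nil => exact ⟨.nil, le_rfl⟩
  | @cons a b c hab p ih =>
    obtain ⟨q, hq⟩ := ih
    rcases hφ hab with h | h
    · exact ⟨q.copy h.symm rfl, by simp; omega⟩
    · exact ⟨.cons h q, by simpa using hq⟩

/-- If the two sets of vertices `P` and `Q` meet at most in `c` and every edge lies in one of them,
then every walk from `P` to `Q` visits `c`. -/
theorem exists_walks_of_separating {P Q : Set V} {c : V} (hPQ : P ∩ Q ⊆ {c})
    (hadj : ∀ a b, G.Adj a b → (a ∈ P ∧ b ∈ P) ∨ (a ∈ Q ∧ b ∈ Q)) {u v : V} (p : G.Walk u v)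
    (hu : u ∈ P) (hv : v ∈ Q) :
    ∃ (p₁ : G.Walk u c) (p₂ : G.Walk c v), p₁.length + p₂.length ≤ p.length := by
  induction p with
  | nil =>
    obtain rfl := hPQ ⟨hu, hv⟩
    exact ⟨.nil, .nil, le_rfl⟩
  | @cons a b d hab p ih =>
    rcases hadj a b hab with ⟨-, hb⟩ | ⟨ha, -⟩
    · obtain ⟨p₁, p₂, h⟩ := ih hb hv
      exact ⟨.cons hab p₁, p₂, by simp only [Walk.length_cons]; omega⟩
    · obtain rfl := hPQ ⟨hu, ha⟩
      exact ⟨.nil, .cons hab p, by simp⟩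

namespace Realization

theorem exists_support_subset (x : G.Realization) :
    ∃ u v, (u = v ∨ G.Adj u v) ∧ (x.coord.support : Set V) ⊆ {u, v} := by
  classical
  obtain ⟨u, v, t, huv, -, -, h⟩ := x.exists_eq
  refine ⟨u, v, huv, fun w hw => ?_⟩
  by_contra hc
  simp only [Set.mem_insert_iff, Set.mem_singleton_iff, not_or] at hc
  simp [h, Ne.symm hc.1, Ne.symm hc.2] at hw

/-- A vertex as a point of the metric graph. -/
noncomputable def vertex (G : SimpleGraph V) (c : V) : G.Realization where
  coord := Finsupp.single c 1
  exists_eq := ⟨c, c, 0, Or.inl rfl, le_rfl, zero_le_one, by simp⟩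

theorem vertex_coord_self (c : V) : (vertex G c).coord c = 1 := by
  simp [vertex]

theorem mem_support_vertex (c : V) : c ∈ (vertex G c).coord.support := by
  simp [vertex]

theorem support_vertex_subset (c : V) : ((vertex G c).coord.support : Set V) ⊆ {c} := by
  simpa only [vertex, Finset.coe_singleton] using
    Finset.coe_subset.2 (Finsupp.support_single_subset (a := c) (b := (1 : ℝ)))

theorem eq_vertex (x : G.Realization) {c : V} (hx : (x.coord.support : Set V) ⊆ {c}) :
    x = vertex G c := by
  ext w
  by_cases hw : w = c
  · subst hw
    rw [vertex_coord_self, x.coord_eq_one (by simpa using hx)]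
  · rw [Finsupp.notMem_support_iff.1 fun h => hw (hx h),
      Finsupp.notMem_support_iff.1 fun h => hw (support_vertex_subset c h)]

theorem edist_le {x y : G.Realization} {ℓ : ℝ} (h : IsPathLength x y ℓ) :
    EDist.edist x y ≤ ENNReal.ofReal ℓ :=
  iInf₂_le ℓ h

/-- The part of the metric graph spanned by a set of vertices. -/
def span (G : SimpleGraph V) (S : Set V) : Set G.Realization :=
  {x | (x.coord.support : Set V) ⊆ S}

theorem vertex_mem_span {S : Set V} {c : V} (hc : c ∈ S) : vertex G c ∈ span G S :=
  (support_vertex_subset c).trans (by simpa using hc)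

theorem span_union {P Q : Set V} (hcov : P ∪ Q = Set.univ)
    (hadj : ∀ a b, G.Adj a b → (a ∈ P ∧ b ∈ P) ∨ (a ∈ Q ∧ b ∈ Q)) :
    span G P ∪ span G Q = Set.univ := by
  refine Set.eq_univ_of_forall fun x => ?_
  obtain ⟨u, v, huv, hx⟩ := x.exists_support_subset
  have hsub : ∀ {S : Set V}, u ∈ S ∧ v ∈ S → x ∈ span G S := fun h =>
    hx.trans (Set.pair_subset h.1 h.2)
  rcases huv with rfl | huv
  · exact (hcov.symm ▸ Set.mem_univ u : u ∈ P ∪ Q).imp (fun h => hsub ⟨h, h⟩)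
      (fun h => hsub ⟨h, h⟩)
  · exact (hadj u v huv).imp hsub hsub

/-- A walk between the two parts splits at `c` without gaining length. -/
theorem isWedgeAt_span {P Q : Set V} {c : V} (hcov : P ∪ Q = Set.univ) (hPQ : P ∩ Q = {c})
    (hadj : ∀ a b, G.Adj a b → (a ∈ P ∧ b ∈ P) ∨ (a ∈ Q ∧ b ∈ Q)) :
    IsWedgeAt (span G P) (span G Q) (vertex G c) := by
  have hc : c ∈ P ∩ Q := hPQ ▸ rfl
  refine ⟨vertex_mem_span hc.1, vertex_mem_span hc.2, fun x hx y hy => ?_⟩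
  refine le_antisymm (PseudoEMetricSpace.edist_triangle _ _ _) (le_iInf₂ fun ℓ hℓ => ?_)
  have hle := edist_le hℓ
  cases hℓ with
  | along_edge u v huv hxs hys =>
    have huv' : (u ∈ P ∧ v ∈ P) ∨ (u ∈ Q ∧ v ∈ Q) := by
      rcases huv with rfl | huv
      · exact (hcov.symm ▸ Set.mem_univ u : u ∈ P ∪ Q).imp (fun h => ⟨h, h⟩) (fun h => ⟨h, h⟩)
      · exact hadj u v huv
    -- The common edge lies in one part, so the point belonging to the other part is supported in `P
    -- ∩ Q`, that is, equals the vertex `c`.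
    rcases huv' with h | h
    · have : y = vertex G c := y.eq_vertex fun w hw =>
        hPQ ▸ ⟨hys.trans (Set.pair_subset h.1 h.2) hw, hy hw⟩
      subst this
      rwa [PseudoEMetricSpace.edist_self, add_zero]
    · have : x = vertex G c := x.eq_vertex fun w hw =>
        hPQ ▸ ⟨hx hw, hxs.trans (Set.pair_subset h.1 h.2) hw⟩
      subst this
      rwa [PseudoEMetricSpace.edist_self, zero_add]
  | through_vertices u v hu hv p =>
    obtain ⟨p₁, p₂, hp⟩ := exists_walks_of_separating hPQ.subset hadj p (hx hu) (hy hv)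
    have h₁ := IsPathLength.through_vertices u c hu (mem_support_vertex (G := G) c) p₁
    have h₂ := IsPathLength.through_vertices c v (mem_support_vertex (G := G) c) hv p₂
    refine (add_le_add (edist_le h₁) (edist_le h₂)).trans ?_
    rw [← ENNReal.ofReal_add h₁.nonneg h₂.nonneg, vertex_coord_self]
    apply ENNReal.ofReal_le_ofReal
    have : (p₁.length : ℝ) + p₂.length ≤ p.length := by exact_mod_cast hp
    linarith

theorem edist_of_mem_span_pair {A B : V} (hAB : G.Adj A B) {x y : G.Realization}
    (hx : x ∈ span G {A, B}) (hy : y ∈ span G {A, B}) :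
    EDist.edist (x.coord A) (y.coord A) = EDist.edist x y := by
  rw [edist_dist, Real.dist_eq]
  refine le_antisymm (le_iInf₂ fun ℓ h => ENNReal.ofReal_le_ofReal (h.abs_sub_le A)) ?_
  exact edist_le (.along_edge A B (Or.inr hAB) hx hy)

theorem isHyperbolicOn_span_pair {A B : V} (hAB : G.Adj A B) (δ : ℝ≥0∞) :
    IsHyperbolicOn (span G {A, B}) δ := by
  have h := IsHyperbolicOn.real_univ.of_isometryOn (f := fun x : G.Realization => x.coord A)
    (Set.mapsTo_univ _ _) fun x hx y hy => edist_of_mem_span_pair hAB hx hy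
  exact fun _ _ _ _ _ _ hs ht hu hs' ht' hu' p hp =>
    (h hs ht hu hs' ht' hu' p hp).trans zero_le

/-- The map of metric graphs induced by a map of vertices which may collapse edges. -/
noncomputable def map {φ : V → W} (hφ : IsWeakHom G H φ) (x : G.Realization) : H.Realization where
  coord := x.coord.mapDomain φ
  exists_eq := by
    obtain ⟨u, v, t, huv, h0, h1, h⟩ := x.exists_eq
    refine ⟨φ u, φ v, t, ?_, h0, h1, ?_⟩
    · rcases huv with rfl | huv
      · exact Or.inl rfl
      · exact hφ huv
    · rw [h, Finsupp.mapDomain_add, Finsupp.mapDomain_single, Finsupp.mapDomain_single]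

/-- Only an inequality in general: the coordinates of vertices merged by `φ` add up. -/
theorem coord_le_map_coord {φ : V → W} (hφ : IsWeakHom G H φ) (x : G.Realization) (u : V) :
    x.coord u ≤ (map hφ x).coord (φ u) := by
  classical
  obtain ⟨a, b, t, -, h0, h1, h⟩ := x.exists_eq
  simp only [map, h, Finsupp.mapDomain_add, Finsupp.mapDomain_single, Finsupp.add_apply,
    Finsupp.single_apply]
  split_ifs <;> first | linarith | simp_all

theorem mem_support_map {φ : V → W} (hφ : IsWeakHom G H φ) (x : G.Realization) {u : V}
    (hu : u ∈ x.coord.support) : φ u ∈ (map hφ x).coord.support := by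
  have h1 : x.coord u ≠ 0 := Finsupp.mem_support_iff.1 hu
  exact Finsupp.mem_support_iff.2
    (((x.coord_nonneg u).lt_of_ne' h1).trans_le (coord_le_map_coord hφ x u)).ne'

theorem map_mem_span {φ : V → W} (hφ : IsWeakHom G H φ) {S : Set V} {S' : Set W}
    (hS : Set.MapsTo φ S S') {x : G.Realization} (hx : x ∈ span G S) :
    map hφ x ∈ span H S' := by
  classical
  intro w hw
  obtain ⟨v, hv, rfl⟩ := Finset.mem_image.1 (Finsupp.mapDomain_support hw)
  exact hS (hx hv)

theorem map_coord_eq {φ : V → W} (hφ : IsWeakHom G H φ) {x : G.Realization} {u v : V}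
    (huv : φ u ≠ φ v) (hx : (x.coord.support : Set V) ⊆ {u, v}) :
    (map hφ x).coord (φ u) = x.coord u := by
  have h1 := coord_le_map_coord hφ x u
  have h2 := coord_le_map_coord hφ x v
  have h3 := (map hφ x).coord_add_le_one huv
  have h4 := x.coord_add_eq_one (ne_of_apply_ne φ huv) hx
  linarith

theorem IsPathLength.exists_map {φ : V → W} (hφ : IsWeakHom G H φ) {x y : G.Realization} {ℓ : ℝ}
    (h : IsPathLength x y ℓ) : ∃ m ≤ ℓ, IsPathLength (map hφ x) (map hφ y) m := by
  cases h with
  | along_edge u v huv hx hy =>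
    have hmaps : Set.MapsTo φ {u, v} {φ u, φ v} := by
      rintro w (rfl | rfl) <;> simp
    have huv' : φ u = φ v ∨ H.Adj (φ u) (φ v) := by
      rcases huv with rfl | huv
      · exact Or.inl rfl
      · exact hφ huv
    have hx' := map_mem_span hφ hmaps (x := x) hx
    have hy' := map_mem_span hφ hmaps (x := y) hy
    refine ⟨_, ?_, .along_edge (φ u) (φ v) huv' hx' hy'⟩
    -- If the edge is collapsed, both image points are the vertex `φ u`, so the new length is zero;
    -- otherwise the coordinates are preserved.
    by_cases hne : φ u = φ v
    · have h1 : ∀ z : H.Realization, z ∈ span H {φ u, φ v} → z.coord (φ u) = 1 := by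
        rw [← hne]
        exact fun z hz => z.coord_eq_one hz
      rw [h1 _ hx', h1 _ hy', sub_self, abs_zero]
      exact abs_nonneg _
    · rw [map_coord_eq hφ hne hx, map_coord_eq hφ hne hy]
  | through_vertices u v hu hv p =>
    obtain ⟨q, hq⟩ := hφ.exists_walk p
    refine ⟨_, ?_, .through_vertices (φ u) (φ v) (mem_support_map hφ x hu)
      (mem_support_map hφ y hv) q⟩
    have h1 := coord_le_map_coord hφ x u
    have h2 := coord_le_map_coord hφ y v
    have h3 : (q.length : ℝ) ≤ p.length := by exact_mod_cast hq
    linarith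

theorem edist_map_le {φ : V → W} (hφ : IsWeakHom G H φ) (x y : G.Realization) :
    EDist.edist (map hφ x) (map hφ y) ≤ EDist.edist x y := by
  refine le_iInf₂ fun ℓ h => ?_
  obtain ⟨m, hm, h'⟩ := h.exists_map hφ
  exact (edist_le h').trans (ENNReal.ofReal_le_ofReal hm)

theorem map_map_of_leftInvOn {φ : V → W} (hφ : IsWeakHom G H φ) {ψ : W → V}
    (hψ : IsWeakHom H G ψ) {S : Set V} (hinv : Set.LeftInvOn ψ φ S) {x : G.Realization}
    (hx : x ∈ span G S) : map hψ (map hφ x) = x := by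
  ext1
  simp only [map]
  rw [← Finsupp.mapDomain_comp]
  exact (Finsupp.mapDomain_congr (g := id) fun v hv => hinv (hx hv)).trans Finsupp.mapDomain_id

/-- Both induced maps are 1-Lipschitz and their composite is the identity over `S`, so the first is
isometric there. -/
theorem isHyperbolicOn_span_of_leftInvOn {φ : V → W} (hφ : IsWeakHom G H φ) {ψ : W → V}
    (hψ : IsWeakHom H G ψ) {S : Set V} {S' : Set W} (hS : Set.MapsTo φ S S')
    (hinv : Set.LeftInvOn ψ φ S) {δ : ℝ≥0∞} (h : IsHyperbolicOn (span H S') δ) :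
    IsHyperbolicOn (span G S) δ := by
  refine h.of_isometryOn (f := map hφ) (fun x hx => map_mem_span hφ hS hx) fun x hx y hy => ?_
  refine le_antisymm (edist_map_le hφ x y) ?_
  conv_lhs => rw [← map_map_of_leftInvOn hφ hψ hinv hx, ← map_map_of_leftInvOn hφ hψ hinv hy]
  exact edist_map_le hψ _ _

end Realization

/-! ### Cut-edges -/

/-- `A` lies in `S`, `B` does not, and `[A, B]` is the only edge which leaves `S`. -/
structure IsCutBy (G : SimpleGraph V) (S : Set V) (A B : V) : Prop where
  left_mem : A ∈ S
  right_notMem : B ∉ S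
  adj : G.Adj A B
  eq_of_adj : ∀ a ∈ S, ∀ b ∉ S, G.Adj a b → a = A ∧ b = B

/-- `S` is the component of `A` once `e` is deleted; any other edge leaving `S` would survive the
deletion and enlarge that component. -/
theorem IsCutEdge.exists_isCutBy (hG : G.Connected) {e : Sym2 V} (he : G.IsCutEdge e) :
    ∃ S A B, e = s(A, B) ∧ G.IsCutBy S A B := by
  induction e using Sym2.ind with | _ A B
  obtain ⟨hAB, hnot⟩ := he
  have hbridge : G.IsBridge s(A, B) := by
    by_contra h
    exact hnot (hG.connected_delete_edge_of_not_isBridge h)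
  have hB : ¬ (G.deleteEdges {s(A, B)}).Reachable A B := isBridge_iff.1 hbridge
  refine ⟨{v | (G.deleteEdges {s(A, B)}).Reachable A v}, A, B, rfl, Reachable.refl A, hB, hAB,
    fun a ha b hb hab => ?_⟩
  by_cases h : s(a, b) = s(A, B)
  · rcases Sym2.eq_iff.1 h with h | ⟨rfl, rfl⟩
    · exact h
    · exact absurd ha hB
  · have : (G.deleteEdges {s(A, B)}).Adj a b := by
      rw [deleteEdges_adj]
      exact ⟨hab, h⟩
    exact absurd (ha.trans this.reachable) hb

namespace IsCutBy

variable {S : Set V} {A B : V}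

theorem symm (h : G.IsCutBy S A B) : G.IsCutBy Sᶜ B A :=
  ⟨h.right_notMem, fun hA => hA h.left_mem, h.adj.symm, fun a ha b hb hab =>
    (h.eq_of_adj b (not_not.1 hb) a ha hab.symm).symm⟩

theorem mem_or_mem (h : G.IsCutBy S A B) {a b : V} (hab : G.Adj a b) :
    (a ∈ insert B S ∧ b ∈ insert B S) ∨ (a ∈ Sᶜ ∧ b ∈ Sᶜ) := by
  by_cases ha : a ∈ S <;> by_cases hb : b ∈ S
  · exact Or.inl ⟨Or.inr ha, Or.inr hb⟩
  · exact Or.inl ⟨Or.inr ha, Or.inl (h.eq_of_adj a ha b hb hab).2⟩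
  · exact Or.inl ⟨Or.inl (h.eq_of_adj b hb a ha hab.symm).2, Or.inr hb⟩
  · exact Or.inr ⟨ha, hb⟩

theorem insert_union_compl (S : Set V) (B : V) : insert B S ∪ Sᶜ = Set.univ := by
  rw [Set.insert_union, Set.union_compl_self, Set.insert_eq_of_mem (Set.mem_univ B)]

theorem insert_inter_compl (h : G.IsCutBy S A B) : insert B S ∩ Sᶜ = {B} := by
  rw [Set.insert_inter_of_mem (show B ∈ Sᶜ from h.right_notMem), Set.inter_compl_self,
    insert_empty_eq]

/-- Two gluings: `S` with the segment `[A, B]` at `A`, then the result with `Sᶜ` at `B`. The segment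
imposes no condition on `δ`. -/
theorem isHyperbolicOn_univ (h : G.IsCutBy S A B) {δ : ℝ≥0∞}
    (hS : IsHyperbolicOn (Realization.span G S) δ)
    (hS' : IsHyperbolicOn (Realization.span G Sᶜ) δ) :
    IsHyperbolicOn (Set.univ : Set G.Realization) δ := by
  have hwedge := Realization.isWedgeAt_span (insert_union_compl S B) h.insert_inter_compl
    fun a b => h.mem_or_mem
  have hcov := Realization.span_union (insert_union_compl S B) fun a b => h.mem_or_mem
  have hcov₂ : insert A Sᶜ ∪ S = Set.univ := by simpa using insert_union_compl Sᶜ A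
  have hadj₂ : ∀ a b, G.Adj a b → (a ∈ insert A Sᶜ ∧ b ∈ insert A Sᶜ) ∨ (a ∈ S ∧ b ∈ S) := by
    simpa using fun a b => h.symm.mem_or_mem (a := a) (b := b)
  have hwedge₂ := Realization.isWedgeAt_span hcov₂ (by simpa using h.symm.insert_inter_compl) hadj₂
  have hsub : Realization.span G {A, B} ⊆ Realization.span G (insert A Sᶜ) := fun x hx =>
    Set.Subset.trans hx (Set.pair_subset (Or.inl rfl) (Or.inr h.right_notMem))
  -- The wedge of `S` with `insert A Sᶜ` at `A` restricts to the segment, which is contained in the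
  -- second set.
  have hwedge₃ : IsWedgeAt (Realization.span G S) (Realization.span G {A, B})
      (Realization.vertex G A) :=
    ⟨hwedge₂.mem_right, Realization.vertex_mem_span (Or.inl rfl), fun x hx y hy =>
      hwedge₂.symm.edist_eq x hx y (hsub hy)⟩
  have hunion := hwedge₃.isHyperbolicOn_union hS (Realization.isHyperbolicOn_span_pair h.adj δ)
  rw [← hcov]
  refine hwedge.isHyperbolicOn_union (hunion.mono fun x hx => ?_) hS'
  have hx' : x ∈ Realization.span G (insert A Sᶜ) ∪ Realization.span G S :=
    Realization.span_union hcov₂ hadj₂ ▸ Set.mem_univ x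
  rcases hx' with hx' | hx'
  -- A support contained in both `insert B S` and `insert A Sᶜ` is contained in `{A, B}`.
  · refine Or.inr fun v hv => ?_
    rcases hx hv with h1 | h1
    · exact Or.inr h1
    · exact Or.inl ((hx' hv).resolve_right fun h2 => h2 h1)
  · exact Or.inl hx'

end IsCutBy

/-! ### Contracting a cut-edge -/

/-- The projection of the vertices of `G` to those of `G/e`. -/
def contractMk (e : Sym2 V) (v : V) : Quotient (contractSetoid e) := Quotient.mk _ v

theorem contractMk_eq_iff {e : Sym2 V} {a b : V} :
    contractMk e a = contractMk e b ↔ a = b ∨ (a ∈ e ∧ b ∈ e) :=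
  Quotient.eq

theorem isWeakHom_contractMk (G : SimpleGraph V) (e : Sym2 V) :
    IsWeakHom G (G.contractEdge e) (contractMk e) := fun a b hab =>
  or_iff_not_imp_left.2 fun h => ⟨h, a, b, hab, rfl, rfl⟩

namespace IsCutBy

variable {S : Set V} {A B : V}

theorem contractMk_left_eq_right : contractMk s(A, B) A = contractMk s(A, B) B :=
  contractMk_eq_iff.2 (Or.inr ⟨Sym2.mem_mk_left A B, Sym2.mem_mk_right A B⟩)

theorem contract_union (S : Set V) (e : Sym2 V) :
    contractMk e '' S ∪ contractMk e '' Sᶜ = Set.univ := by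
  rw [← Set.image_union, Set.union_compl_self, Set.image_univ]
  exact Set.range_eq_univ.2 Quotient.mk_surjective

theorem contract_inter (h : G.IsCutBy S A B) :
    contractMk s(A, B) '' S ∩ contractMk s(A, B) '' Sᶜ = {contractMk s(A, B) A} := by
  refine Set.eq_singleton_iff_unique_mem.2
    ⟨⟨⟨A, h.left_mem, rfl⟩, B, h.right_notMem, contractMk_left_eq_right.symm⟩, ?_⟩
  rintro _ ⟨⟨a, ha, rfl⟩, b, hb, hab⟩
  rcases contractMk_eq_iff.1 hab with rfl | ⟨-, ha'⟩
  · exact absurd ha hb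
  · exact contractMk_eq_iff.2 (Or.inr ⟨ha', Sym2.mem_mk_left A B⟩)

theorem contract_mem_or_mem (h : G.IsCutBy S A B) (p q : Quotient (contractSetoid s(A, B)))
    (hpq : (G.contractEdge s(A, B)).Adj p q) :
    (p ∈ contractMk s(A, B) '' S ∧ q ∈ contractMk s(A, B) '' S) ∨
      (p ∈ contractMk s(A, B) '' Sᶜ ∧ q ∈ contractMk s(A, B) '' Sᶜ) := by
  obtain ⟨hne, a, b, hab, rfl, rfl⟩ := hpq
  by_cases ha : a ∈ S <;> by_cases hb : b ∈ S
  · exact Or.inl ⟨⟨a, ha, rfl⟩, b, hb, rfl⟩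
  · obtain ⟨rfl, rfl⟩ := h.eq_of_adj a ha b hb hab
    exact absurd contractMk_left_eq_right hne
  · obtain ⟨rfl, rfl⟩ := h.eq_of_adj b hb a ha hab.symm
    exact absurd contractMk_left_eq_right.symm hne
  · exact Or.inr ⟨⟨a, ha, rfl⟩, b, hb, rfl⟩

-- The section comes from collapsing all of `Sᶜ` to `A`. It respects the merging of `A` and `B`, and
-- it is a weak homomorphism because the only edge leaving `S` starts at `A` and is itself
-- collapsed.
open Classical in
theorem exists_section (h : G.IsCutBy S A B) :
    ∃ ψ, IsWeakHom (G.contractEdge s(A, B)) G ψ ∧ Set.LeftInvOn ψ (contractMk s(A, B)) S := by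
  let r : V → V := fun v => if v ∈ S then v else A
  have hr : ∀ v, v ∈ s(A, B) → r v = A := by
    intro v hv
    rcases Sym2.mem_iff.1 hv with rfl | rfl
    · exact if_pos h.left_mem
    · exact if_neg h.right_notMem
  refine ⟨Quotient.lift r ?_, ?_, fun v hv => if_pos hv⟩
  · intro a b hab
    obtain rfl | ⟨ha, hb⟩ : a = b ∨ (a ∈ s(A, B) ∧ b ∈ s(A, B)) := hab
    · rfl
    · rw [hr a ha, hr b hb]
  · rintro _ _ ⟨-, a, b, hab, rfl, rfl⟩
    change r a = r b ∨ G.Adj (r a) (r b)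
    by_cases ha : a ∈ S <;> by_cases hb : b ∈ S <;> simp only [r, ha, hb, if_true, if_false]
    · exact Or.inr hab
    · exact Or.inl (h.eq_of_adj a ha b hb hab).1
    · exact Or.inl (h.eq_of_adj b hb a ha hab.symm).1.symm
    · exact Or.inl trivial

/-- The projection and the section are mutually inverse between `S` and its image, so the transfer
lemma applies with either one in the leading role. -/
theorem isHyperbolicOn_contract_iff (h : G.IsCutBy S A B) (δ : ℝ≥0∞) :
    IsHyperbolicOn (Realization.span (G.contractEdge s(A, B)) (contractMk s(A, B) '' S)) δ ↔
      IsHyperbolicOn (Realization.span G S) δ := by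
  obtain ⟨ψ, hψ, hinv⟩ := h.exists_section
  constructor
  · exact Realization.isHyperbolicOn_span_of_leftInvOn (isWeakHom_contractMk G _) hψ
      (Set.mapsTo_image _ _) hinv
  · refine Realization.isHyperbolicOn_span_of_leftInvOn hψ (isWeakHom_contractMk G _) ?_ ?_
    · rintro _ ⟨v, hv, rfl⟩
      rwa [hinv hv]
    · rintro _ ⟨v, hv, rfl⟩
      rw [hinv hv]

/-- Both sides are equivalent to `δ`-hyperbolicity of the parts over `S` and `Sᶜ`. -/
theorem isHyperbolicOn_univ_contract_iff (h : G.IsCutBy S A B) (δ : ℝ≥0∞) :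
    IsHyperbolicOn (Set.univ : Set (G.contractEdge s(A, B)).Realization) δ ↔
      IsHyperbolicOn (Set.univ : Set G.Realization) δ := by
  have h₁ := h.isHyperbolicOn_contract_iff δ
  have h₂ := h.symm.isHyperbolicOn_contract_iff δ
  -- The reversed cut contracts `s(B, A)`, the same unordered edge; the rewriting makes the two
  -- quotient types agree.
  rw [Sym2.eq_swap] at h₂
  constructor
  · exact fun hδ => h.isHyperbolicOn_univ (h₁.1 (hδ.mono (Set.subset_univ _)))
      (h₂.1 (hδ.mono (Set.subset_univ _)))
  · intro hδ
    rw [← Realization.span_union (contract_union S s(A, B)) h.contract_mem_or_mem]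
    exact (Realization.isWedgeAt_span (contract_union S s(A, B)) h.contract_inter
      h.contract_mem_or_mem).isHyperbolicOn_union (h₁.2 (hδ.mono (Set.subset_univ _)))
      (h₂.2 (hδ.mono (Set.subset_univ _)))

end IsCutBy

end SimpleGraph

theorem theorem2p12 {V : Type*} (G : SimpleGraph V) (hG : G.Connected) (e : Sym2 V)
    (he : G.IsCutEdge e) :
    hyperbolicityConstant (G.contractEdge e).Realization = hyperbolicityConstant G.Realization := by
  obtain ⟨S, A, B, rfl, hS⟩ := he.exists_isCutBy hG
  -- Two elements of `[0, ∞]` with the same upper bounds are equal, so only bounds `≤ δ` need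
  -- comparison, including the case of infinite constants.
  refine eq_of_forall_ge_iff fun δ => ?_
  rw [hyperbolicityConstant_le_iff, hyperbolicityConstant_le_iff,
    hS.isHyperbolicOn_univ_contract_iff]
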